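/- **Theorem 5.** For integers $s,m\ge 0$, an integer $0\le j\le m$, $\alpha\in[0,1]$ and $z\in[0,1]$ let $q_{m,j}(z)=\binom{m}{j}z^{j}(1-z)^{m-j}$, and let $q^{(\alpha,s)}_{m,j}(z)=q_{m,j}(z)$ if $m<s$, while for $m\ge s$ $$q^{(\alpha,s)}_{m,j}(z)=(1-\alpha)\binom{m-s}{j-s}z^{j-s+1}(1-z)^{m-j}+(1-\alpha)\binom{m-s}{j}z^{j}(1-z)^{m-s-j+1}+\alpha\binom{m}{j}z^{j}(1-z)^{m-j},$$ where $\binom{n}{k}=0$ (and the whole term it multiplies is $0$) unless $0\le k\le n$. For $\eta>0$, $\gamma>0$ and $\phi\in C[0,1]$ put $$\Re(\phi;z)=\Re^{(\alpha,s)}_{m,\eta,\gamma}(\phi;z)=\Gamma(\eta+1)\sum_{j=0}^{m}q^{(\alpha,s)}_{m,j}(z)\int_0^1\frac{(1-t)^{\eta-1}}{\Gamma(\eta)}\,\phi\!\left(\frac{j+t^{\gamma}}{m+1}\right)dt ,$$ and let $\zeta(z)=\Re(t-z;z)$ and $\varphi(z)=\Re((t-z)^2;z)$ be its first and second central moments.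 For $\delta\ge 0$ let $$\omega(\phi;\delta)=\sup\{|\phi(u+h)-\phi(u)|:\ 0<h\le\delta,\ u,u+h\in[0,1]\},$$ $$\omega_2(\phi;\delta)=\sup\{|\phi(u+2h)-2\phi(u+h)+\phi(u)|:\ 0<h\le\delta,\ u,u+2h\in[0,1]\}$$ (with value $0$ at $\delta=0$). Then there is an absolute constant $C>0$ such that, for all $\eta>0$, $\gamma>0$, $\alpha\in[0,1]$, all integers $s,m\ge 0$, all $\phi\in C[0,1]$ and all $z\in[0,1]$, $$|\Re(\phi;z)-\phi(z)|\le C\,\omega_2\!\Big(\phi;\tfrac12\sqrt{\varphi(z)+\zeta(z)^2}\Big)+\omega\big(\phi;|\zeta(z)|\big).$$ -/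

import Mathlib

noncomputable section

namespace FracBernstein

/-- The classical Bernstein basis polynomial `binom m j * z ^ j * (1 - z) ^ (m - j)` of degree `m`. -/
def bernsteinBasis (m j : ℕ) (z : ℝ) : ℝ :=
  (m.choose j : ℝ) * z ^ j * (1 - z) ^ (m - j)

/-- The blending `(α, s)`-Bernstein basis of degree `m`, with node index `0 ≤ j ≤ m`.
It is the Bernstein basis when `m < s`; when `s ≤ m` it is
`(1 - α) * binom (m - s) (j - s) * z ^ (j - s + 1) * (1 - z) ^ (m - j)
  + (1 - α) * binom (m - s) j * z ^ j * (1 - z) ^ (m - s - j + 1)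
  + α * binom m j * z ^ j * (1 - z) ^ (m - j)`,
where a binomial coefficient `binom n k` is zero unless `0 ≤ k ≤ n`. The inner `if` implements this
convention for `j < s`, where the subtraction `j - s` of natural numbers would truncate; in the
other terms the coefficient is zero whenever an exponent truncates. -/
def blendingBasis (α : ℝ) (s m j : ℕ) (z : ℝ) : ℝ :=
  if m < s then bernsteinBasis m j z
  else
    (1 - α) *
        (if s ≤ j then ((m - s).choose (j - s) : ℝ) * z ^ (j - s + 1) * (1 - z) ^ (m - j) else 0)
      + (1 - α) * (((m - s).choose j : ℝ) * z ^ j * (1 - z) ^ (m - s - j + 1))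
      + α * bernsteinBasis m j z

/-- The Riemann-Liouville type fractional blending Bernstein-Kantorovich operator. -/
def fracOp (η γ α : ℝ) (s m : ℕ) (φ : ℝ → ℝ) (z : ℝ) : ℝ :=
  Real.Gamma (η + 1) * ∑ j ∈ Finset.range (m + 1), blendingBasis α s m j z *
    ∫ t in (0 : ℝ)..1,
      (1 - t) ^ (η - 1) / Real.Gamma η * φ (((j : ℝ) + t ^ γ) / ((m : ℝ) + 1))

/-- First central moment of the operator at `z`. -/
def centralMoment₁ (η γ α : ℝ) (s m : ℕ) (z : ℝ) : ℝ :=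
  fracOp η γ α s m (fun t => t - z) z

/-- Second central moment of the operator at `z`. -/
def centralMoment₂ (η γ α : ℝ) (s m : ℕ) (z : ℝ) : ℝ :=
  fracOp η γ α s m (fun t => (t - z) ^ 2) z

/-- The modulus of continuity on `[0, 1]`. For `φ` continuous on `[0, 1]` the set is bounded; it is
empty exactly when `δ ≤ 0`, and then the value is `0`. -/
def modulus (φ : ℝ → ℝ) (δ : ℝ) : ℝ :=
  sSup {y : ℝ | ∃ h u : ℝ, 0 < h ∧ h ≤ δ ∧ 0 ≤ u ∧ u + h ≤ 1 ∧ y = |φ (u + h) - φ u|}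

/-- The second-order modulus of smoothness on `[0, 1]`. For `φ` continuous on `[0, 1]` the set is
bounded; it is empty exactly when `δ ≤ 0`, and then the value is `0`. -/
def modulus₂ (φ : ℝ → ℝ) (δ : ℝ) : ℝ :=
  sSup {y : ℝ | ∃ h u : ℝ, 0 < h ∧ h ≤ δ ∧ 0 ≤ u ∧ u + 2 * h ≤ 1 ∧
    y = |φ (u + 2 * h) - 2 * φ (u + h) + φ u|}

end FracBernstein

end

namespace FracBernstein

open Set

/-! ### Local and global approximation by affine functions -/

/-! The operator `T` averages against a probability measure on `[0, 1]` whose mean is `x = z +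
ζ(z)`. Split `|Tφ - φ(z)| ≤ |Tφ - φ(x)| + |φ(x) - φ(z)|`; the last term is at most `ω(φ; |ζ|)`.

For the other, `exists_slope_modulus₂` gives an affine `ℓ` with `ℓ(x) = φ(x)` and `|φ - ℓ| ≤ 19 (5 +
(t - x)² / h²) ω₂(φ; h)` on `[0, 1]`. As `Tℓ = ℓ(x) = φ(x)`, positivity bounds `|Tφ - φ(x)|` by `T`
of this quadratic, and `h = ½ √(φ(z) + ζ²)`, with `φ(z)` the second moment, makes it a constant
times `ω₂`.

The slope of `ℓ` is that of a chord of `φ` over a window of length `2h` around `x`: second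
differences control the error inside the window and let it grow at most quadratically outside. -/

/-- A continuous function vanishing at the endpoints of an interval is bounded by its second
differences there. -/
theorem abs_le_of_secondDiff_le {f : ℝ → ℝ} {a h w : ℝ} (hh : 0 < h)
    (hf : ContinuousOn f (Icc a (a + 2 * h))) (ha : f a = 0) (hb : f (a + 2 * h) = 0)
    (hw : ∀ k u, 0 < k → k ≤ h → a ≤ u → u + 2 * k ≤ a + 2 * h →
      |f (u + 2 * k) - 2 * f (u + k) + f u| ≤ w) :
    ∀ t ∈ Icc a (a + 2 * h), |f t| ≤ w := by
  obtain ⟨p, ⟨hp1, hp2⟩, hmax⟩ := isCompact_Icc.exists_isMaxOn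
    (nonempty_Icc.2 (by linarith : a ≤ a + 2 * h)) hf.abs
  have hM : ∀ t ∈ Icc a (a + 2 * h), |f t| ≤ |f p| := fun t ht => hmax ht
  have hw0 : 0 ≤ w := (abs_nonneg _).trans (hw h a hh le_rfl le_rfl le_rfl)
  suffices |f p| ≤ w from fun t ht => (hM t ht).trans this
  rcases hp1.eq_or_lt with rfl | hp1
  · simpa [ha] using hw0
  rcases hp2.eq_or_lt with rfl | hp2
  · simpa [hb] using hw0
  -- Reflect the nearer endpoint, a zero of `f`, through the maximum point `p`. The second
  -- difference centred at `p` gives `2|f p| ≤ w + |f p|`.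
  rcases le_total p (a + h) with hp | hp
  · have h1 := hw (p - a) a (by linarith) (by linarith) le_rfl (by linarith)
    have h2 := hM (a + 2 * (p - a)) ⟨by linarith, by linarith⟩
    rw [add_sub_cancel, ha, abs_le] at h1
    rw [abs_le] at h2
    rcases abs_cases (f p) with ⟨h3, h4⟩ | ⟨h3, h4⟩ <;> linarith [h1.1, h1.2, h2.1, h2.2]
  · have h1 := hw (a + 2 * h - p) (2 * p - a - 2 * h) (by linarith) (by linarith) (by linarith)
      (by linarith)
    have h2 := hM (2 * p - a - 2 * h) ⟨by linarith, by linarith⟩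
    rw [show 2 * p - a - 2 * h + 2 * (a + 2 * h - p) = a + 2 * h by ring,
      show 2 * p - a - 2 * h + (a + 2 * h - p) = p by ring, hb, abs_le] at h1
    rw [abs_le] at h2
    rcases abs_cases (f p) with ⟨h3, h4⟩ | ⟨h3, h4⟩ <;> linarith [h1.1, h1.2, h2.1, h2.2]

/-- A function bounded on a window and with bounded second differences of step `h` grows at most
quadratically to the right of the window. -/
theorem abs_le_quadratic_right {g : ℝ → ℝ} {p q h w : ℝ} (hh : 0 < h)
    (hg : ∀ t ∈ Icc p (p + 2 * h), |g t| ≤ w)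
    (hw : ∀ u, p ≤ u → u + 2 * h ≤ q → |g (u + 2 * h) - 2 * g (u + h) + g u| ≤ w)
    {t : ℝ} (hpt : p ≤ t) (htq : t ≤ q) : |g t| ≤ (1 + (t - p) / h) ^ 2 * w := by
  have hw0 : 0 ≤ w := (abs_nonneg _).trans (hg p ⟨le_rfl, by linarith⟩)
  -- First differences start at most `2w` and gain at most `w` per step; summing them gives the
  -- quadratic growth in `grow`.
  have step : ∀ (k : ℕ) (r : ℝ), r ∈ Icc p (p + h) → r + (k + 1) * h ≤ q →
      |g (r + (k + 1) * h) - g (r + k * h)| ≤ (k + 2) * w := by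
    intro k r hr
    induction k with
    | zero =>
      intro _
      have h1 := hg (r + h) ⟨by linarith [hr.1], by linarith [hr.2]⟩
      have h2 := hg r ⟨hr.1, by linarith [hr.2]⟩
      rw [abs_le] at h1 h2
      norm_num
      rw [abs_le]
      constructor <;> linarith [h1.1, h1.2, h2.1, h2.2]
    | succ k ih =>
      intro hq
      push_cast at hq ⊢
      have h0 : 0 ≤ (k : ℝ) * h := by positivity
      have h1 := ih (by linarith)
      have h2 := hw (r + k * h) (by linarith [hr.1]) (by linarith)
      rw [show r + k * h + 2 * h = r + (k + 1 + 1) * h by ring,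
        show r + k * h + h = r + (k + 1) * h by ring] at h2
      rw [abs_le] at h1 h2 ⊢
      constructor <;> linarith [h1.1, h1.2, h2.1, h2.2]
  have grow : ∀ (k : ℕ) (r : ℝ), r ∈ Icc p (p + h) → r + k * h ≤ q →
      |g (r + k * h)| ≤ (k + 1) ^ 2 * w := by
    intro k r hr
    induction k with
    | zero =>
      intro _
      simpa using hg r ⟨hr.1, by linarith [hr.2]⟩
    | succ k ih =>
      intro hq
      push_cast at hq ⊢
      have h1 := ih (by linarith)
      have h2 := step k r hr hq
      have h3 : 0 ≤ (k : ℝ) * w := by positivity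
      rw [abs_le] at h1 h2 ⊢
      constructor <;> linarith [h1.1, h1.2, h2.1, h2.2]
  have hd : 0 ≤ (t - p) / h := div_nonneg (by linarith) hh.le
  have hfl := Nat.floor_le hd
  have hlt := Nat.lt_floor_add_one ((t - p) / h)
  set k := ⌊(t - p) / h⌋₊
  rw [le_div_iff₀ hh] at hfl
  rw [div_lt_iff₀ hh] at hlt
  have hb := grow k (t - k * h) ⟨by linarith, by linarith⟩ (by linarith)
  rw [sub_add_cancel, add_comm (k : ℝ)] at hb
  refine hb.trans ?_
  have : (k : ℝ) ≤ (t - p) / h := (le_div_iff₀ hh).2 hfl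
  gcongr

/-- The two-sided version of `abs_le_quadratic_right`, on the unit interval. -/
theorem abs_le_quadratic {g : ℝ → ℝ} {p h w x : ℝ} (hh : 0 < h)
    (hg : ∀ t ∈ Icc p (p + 2 * h), |g t| ≤ w)
    (hw : ∀ u, 0 ≤ u → u + 2 * h ≤ 1 → |g (u + 2 * h) - 2 * g (u + h) + g u| ≤ w)
    (hp0 : 0 ≤ p) (hp1 : p + 2 * h ≤ 1) (hx : x ∈ Icc p (p + 2 * h))
    {t : ℝ} (ht : t ∈ Icc (0 : ℝ) 1) : |g t| ≤ 18 * (1 + (t - x) ^ 2 / h ^ 2) * w := by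
  have hw0 : 0 ≤ w := (abs_nonneg _).trans (hg p ⟨le_rfl, by linarith⟩)
  -- Here `d` is the distance from `t` to the far end of the window. With `y = |t - x| / h`, `(3 +
  -- y)² ≤ 18 + 2y²`.
  have key : ∀ d : ℝ, 0 ≤ d → d ≤ |t - x| + 2 * h →
      (1 + d / h) ^ 2 * w ≤ 18 * (1 + (t - x) ^ 2 / h ^ 2) * w := by
    intro d hd0 hd
    apply mul_le_mul_of_nonneg_right _ hw0
    have h1 : d / h ≤ |t - x| / h + 2 := by
      rw [div_le_iff₀ hh, add_mul, div_mul_cancel₀ _ hh.ne']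
      exact hd
    have h2 : (t - x) ^ 2 / h ^ 2 = (|t - x| / h) ^ 2 := by rw [div_pow, sq_abs]
    rw [h2]
    have h3 : 0 ≤ d / h := by positivity
    have h4 : 0 ≤ |t - x| / h := by positivity
    nlinarith [sq_nonneg (|t - x| / h - 3)]
  rcases le_total p t with hpt | hpt
  · refine (abs_le_quadratic_right hh hg (fun u hu hu' => hw u (by linarith) hu')
      hpt ht.2).trans (key _ (by linarith) ?_)
    linarith [le_abs_self (t - x), hx.2]
  -- Points left of the window are handled by the reflection `y ↦ -y`.
  · have := abs_le_quadratic_right (g := fun y => g (-y)) (p := -(p + 2 * h)) (q := 0) (w := w)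
      (t := -t) hh (fun y hy => hg (-y) ⟨by linarith [hy.2], by linarith [hy.1]⟩)
      (fun u hu hu' => ?_) (by linarith) (by linarith [ht.1])
    · simp only [neg_neg] at this
      refine this.trans (key _ (by linarith) ?_)
      linarith [neg_abs_le (t - x), hx.1]
    · have h1 := hw (-(u + 2 * h)) (by linarith) (by linarith)
      rw [show -(u + 2 * h) + 2 * h = -u by ring, show -(u + 2 * h) + h = -(u + h) by ring] at h1
      rw [abs_le] at h1 ⊢
      constructor <;> linarith [h1.1, h1.2]

/-- A function on the unit interval is approximated by an affine function through a given point,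
with error controlled by the second differences of step at most `h`. -/
theorem exists_slope_of_secondDiff_le {φ : ℝ → ℝ} (hφ : ContinuousOn φ (Icc 0 1))
    {h w x : ℝ} (hh : 0 < h) (hh2 : h ≤ 1 / 2) (hx : x ∈ Icc (0 : ℝ) 1)
    (hw : ∀ k u, 0 < k → k ≤ h → 0 ≤ u → u + 2 * k ≤ 1 →
      |φ (u + 2 * k) - 2 * φ (u + k) + φ u| ≤ w) :
    ∃ a : ℝ, ∀ t ∈ Icc (0 : ℝ) 1,
      |φ t - φ x - a * (t - x)| ≤ 19 * (1 + (t - x) ^ 2 / h ^ 2) * w := by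
  -- The window starts at `x` unless it would overrun `1`.
  set p := min x (1 - 2 * h)
  have hp0 : 0 ≤ p := le_min hx.1 (by linarith)
  have hp1 : p + 2 * h ≤ 1 := by linarith [min_le_right x (1 - 2 * h)]
  have hxp : x ∈ Icc p (p + 2 * h) := by
    refine ⟨min_le_left _ _, ?_⟩
    have : x - 2 * h ≤ p := le_min (by linarith) (by linarith [hx.2])
    linarith
  set a := (φ (p + 2 * h) - φ p) / (2 * h)
  have haeq : a * (2 * h) = φ (p + 2 * h) - φ p := div_mul_cancel₀ _ (by positivity)
  set g : ℝ → ℝ := fun t => φ t - φ p - a * (t - p) with hgdef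
  have hgw : ∀ k u, 0 < k → k ≤ h → 0 ≤ u → u + 2 * k ≤ 1 →
      |g (u + 2 * k) - 2 * g (u + k) + g u| ≤ w := by
    intro k u h1 h2 h3 h4
    convert hw k u h1 h2 h3 h4 using 2
    simp only [hgdef]
    ring
  have hgloc : ∀ t ∈ Icc p (p + 2 * h), |g t| ≤ w := by
    refine abs_le_of_secondDiff_le hh ?_ (by simp [hgdef]) ?_
      (fun k u h1 h2 h3 h4 => hgw k u h1 h2 (by linarith) (by linarith))
    · have : ContinuousOn φ (Icc p (p + 2 * h)) := hφ.mono (Icc_subset_Icc hp0 hp1)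
      fun_prop
    · simp only [hgdef]
      linarith
  refine ⟨a, fun t ht => ?_⟩
  have h1 := abs_le_quadratic hh hgloc (fun u => hgw h u hh le_rfl) hp0 hp1 hxp ht
  have h2 := hgloc x hxp
  have hw0 : 0 ≤ w := (abs_nonneg _).trans h2
  have h3 : 0 ≤ (t - x) ^ 2 / h ^ 2 * w := by positivity
  have h4 : φ t - φ x - a * (t - x) = g t - g x := by simp only [hgdef]; ring
  rw [h4]
  -- Moving the base point from `p` to `x` costs `|g x| ≤ w`, whence `19 = 18 + 1`.
  refine (abs_sub _ _).trans ?_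
  linarith

/-! ### The moduli of a continuous function -/

theorem secondDiff_le_modulus₂ {φ : ℝ → ℝ} (hφ : ContinuousOn φ (Icc 0 1)) {δ h u : ℝ}
    (h0 : 0 < h) (hδ : h ≤ δ) (hu : 0 ≤ u) (hu1 : u + 2 * h ≤ 1) :
    |φ (u + 2 * h) - 2 * φ (u + h) + φ u| ≤ modulus₂ φ δ := by
  obtain ⟨M, hM⟩ := isCompact_Icc.exists_bound_of_continuousOn hφ
  refine le_csSup ⟨4 * M, ?_⟩ ⟨h, u, h0, hδ, hu, hu1, rfl⟩
  rintro y ⟨h, u, h0, -, hu, hu1, rfl⟩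
  have h1 := hM u ⟨hu, by linarith⟩
  have h2 := hM (u + h) ⟨by linarith, by linarith⟩
  have h3 := hM (u + 2 * h) ⟨by linarith, by linarith⟩
  rw [Real.norm_eq_abs, abs_le] at h1 h2 h3
  rw [abs_le]
  constructor <;> linarith [h1.1, h1.2, h2.1, h2.2, h3.1, h3.2]

theorem modulus₂_nonneg (φ : ℝ → ℝ) (δ : ℝ) : 0 ≤ modulus₂ φ δ :=
  Real.sSup_nonneg (by rintro y ⟨h, u, -, -, -, -, rfl⟩; exact abs_nonneg _)

theorem modulus_nonneg (φ : ℝ → ℝ) (δ : ℝ) : 0 ≤ modulus φ δ :=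
  Real.sSup_nonneg (by rintro y ⟨h, u, -, -, -, -, rfl⟩; exact abs_nonneg _)

theorem abs_sub_le_modulus {φ : ℝ → ℝ} (hφ : ContinuousOn φ (Icc 0 1)) {x y : ℝ}
    (hx : x ∈ Icc (0 : ℝ) 1) (hy : y ∈ Icc (0 : ℝ) 1) : |φ x - φ y| ≤ modulus φ |x - y| := by
  wlog hxy : y ≤ x generalizing x y
  · rw [abs_sub_comm, abs_sub_comm x y]
    exact this hy hx (le_of_not_ge hxy)
  rcases hxy.eq_or_lt with rfl | hxy
  · simpa using modulus_nonneg φ 0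
  obtain ⟨M, hM⟩ := isCompact_Icc.exists_bound_of_continuousOn hφ
  refine le_csSup ⟨2 * M, ?_⟩ ⟨x - y, y, by linarith, le_abs_self _, hy.1, by linarith [hx.2], ?_⟩
  · rintro y ⟨h, u, h0, -, hu, hu1, rfl⟩
    have h1 := hM u ⟨hu, by linarith⟩
    have h2 := hM (u + h) ⟨by linarith, by linarith⟩
    rw [Real.norm_eq_abs, abs_le] at h1 h2
    rw [abs_le]
    constructor <;> linarith [h1.1, h1.2, h2.1, h2.2]
  · rw [add_sub_cancel]

/-- A window needs `h ≤ 1/2`, so larger steps are cut to `1/2`; then `1 + 4(t - x)² ≤ 5`, which is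
the source of the `5`. -/
theorem exists_slope_modulus₂ {φ : ℝ → ℝ} (hφ : ContinuousOn φ (Icc 0 1))
    {h x : ℝ} (hh : 0 < h) (hx : x ∈ Icc (0 : ℝ) 1) :
    ∃ a : ℝ, ∀ t ∈ Icc (0 : ℝ) 1,
      |φ t - φ x - a * (t - x)| ≤ 19 * (5 + (t - x) ^ 2 / h ^ 2) * modulus₂ φ h := by
  obtain ⟨a, ha⟩ := exists_slope_of_secondDiff_le hφ (h := min h (1 / 2)) (w := modulus₂ φ h)
    (by positivity) (min_le_right _ _) hx
    (fun k u h1 h2 => secondDiff_le_modulus₂ hφ h1 (h2.trans (min_le_left _ _)))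
  refine ⟨a, fun t ht => (ha t ht).trans (mul_le_mul_of_nonneg_right ?_ (modulus₂_nonneg _ _))⟩
  rcases le_total h (1 / 2) with hle | hle
  · rw [min_eq_left hle]
    linarith
  · rw [min_eq_right hle]
    have h1 : 0 ≤ (t - x) ^ 2 / h ^ 2 := by positivity
    have h2 : (t - x) ^ 2 ≤ 1 := by
      rw [sq_le_one_iff_abs_le_one, abs_le]
      constructor <;> linarith [ht.1, ht.2, hx.1, hx.2]
    norm_num
    linarith

/-- A continuous function deviates from its value at a point by at most an arbitrarily small
constant plus a quadratic term. -/
theorem exists_abs_sub_le_add_sq {φ : ℝ → ℝ} (hφ : ContinuousOn φ (Icc 0 1)) {z ε : ℝ}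
    (hz : z ∈ Icc (0 : ℝ) 1) (hε : 0 < ε) :
    ∃ K : ℝ, ∀ t ∈ Icc (0 : ℝ) 1, |φ t - φ z| ≤ ε + K * (t - z) ^ 2 := by
  obtain ⟨M, hM⟩ := isCompact_Icc.exists_bound_of_continuousOn hφ
  obtain ⟨δ, hδ, hd⟩ := Metric.continuousWithinAt_iff.1 (hφ z hz) ε hε
  have hM0 : 0 ≤ M := (norm_nonneg _).trans (hM z hz)
  refine ⟨2 * M / δ ^ 2, fun t ht => ?_⟩
  rcases lt_or_ge (dist t z) δ with h | h
  · have h1 := hd ht h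
    rw [Real.dist_eq] at h1
    have : 0 ≤ 2 * M / δ ^ 2 * (t - z) ^ 2 := by positivity
    linarith
  · rw [Real.dist_eq] at h
    have h1 : 2 * M ≤ 2 * M / δ ^ 2 * (t - z) ^ 2 := by
      rw [div_mul_eq_mul_div, le_div_iff₀ (by positivity)]
      gcongr 2 * M * ?_
      rw [← sq_abs (t - z)]
      gcongr
    have h2 := hM t ht
    have h3 := hM z hz
    rw [Real.norm_eq_abs, abs_le] at h2 h3
    rw [abs_le]
    constructor <;> linarith [h2.1, h2.2, h3.1, h3.2]

/-! ### The blending basis is a partition of unity -/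

theorem bernsteinBasis_nonneg (m j : ℕ) {z : ℝ} (hz : z ∈ Icc (0 : ℝ) 1) :
    0 ≤ bernsteinBasis m j z := by
  have h0 := hz.1
  have h1 : 0 ≤ 1 - z := sub_nonneg.2 hz.2
  unfold bernsteinBasis
  positivity

theorem sum_bernsteinBasis (m : ℕ) (z : ℝ) :
    ∑ j ∈ Finset.range (m + 1), bernsteinBasis m j z = 1 := by
  have h := add_pow z (1 - z) m
  rw [add_sub_cancel, one_pow] at h
  rw [h]
  exact Finset.sum_congr rfl fun j _ => by unfold bernsteinBasis; ring

theorem blendingBasis_nonneg {α : ℝ} (h0 : 0 ≤ α) (h1 : α ≤ 1) (s m j : ℕ) {z : ℝ}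
    (hz : z ∈ Icc (0 : ℝ) 1) : 0 ≤ blendingBasis α s m j z := by
  have hb := bernsteinBasis_nonneg m j hz
  have hz0 := hz.1
  have hz1 : 0 ≤ 1 - z := sub_nonneg.2 hz.2
  have hα : 0 ≤ 1 - α := sub_nonneg.2 h1
  unfold blendingBasis
  split_ifs <;> positivity

/-- For `s ≤ m`, the first two pieces are Bernstein bases of degree `m - s` times `z` (indices
shifted by `s`) and times `1 - z`, so the total is `(1 - α) z + (1 - α)(1 - z) + α`. -/
theorem sum_blendingBasis (α : ℝ) (s m : ℕ) (z : ℝ) :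
    ∑ j ∈ Finset.range (m + 1), blendingBasis α s m j z = 1 := by
  unfold blendingBasis
  split_ifs with hms
  · exact sum_bernsteinBasis m z
  obtain ⟨n, rfl⟩ := Nat.exists_eq_add_of_le (not_lt.1 hms)
  rw [Finset.sum_add_distrib, Finset.sum_add_distrib, ← Finset.mul_sum, ← Finset.mul_sum,
    ← Finset.mul_sum, sum_bernsteinBasis, Nat.add_sub_cancel_left]
  have hA : ∑ j ∈ Finset.range (s + n + 1),
      (if s ≤ j then (n.choose (j - s) : ℝ) * z ^ (j - s + 1) * (1 - z) ^ (s + n - j) else 0)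
        = z := by
    rw [add_assoc, Finset.sum_range_add, Finset.sum_eq_zero, zero_add]
    · refine Eq.trans ?_ ((congrArg (z * ·) (sum_bernsteinBasis n z)).trans (mul_one z))
      simp only [Finset.mul_sum]
      refine Finset.sum_congr rfl fun i _ => ?_
      rw [if_pos (Nat.le_add_right _ _), Nat.add_sub_cancel_left, Nat.add_sub_add_left]
      unfold bernsteinBasis
      ring
    · intro i hi
      rw [if_neg (not_le.2 (Finset.mem_range.1 hi))]
  have hB : ∑ j ∈ Finset.range (s + n + 1),
      (n.choose j : ℝ) * z ^ j * (1 - z) ^ (n - j + 1) = 1 - z := by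
    rw [show s + n + 1 = (n + 1) + s by ring, Finset.sum_range_add, add_eq_left.2]
    · refine Eq.trans ?_ ((congrArg ((1 - z) * ·) (sum_bernsteinBasis n z)).trans (mul_one _))
      simp only [Finset.mul_sum]
      refine Finset.sum_congr rfl fun i _ => ?_
      unfold bernsteinBasis
      ring
    · refine Finset.sum_eq_zero fun i _ => ?_
      rw [Nat.choose_eq_zero_of_lt (by omega)]
      simp
  rw [hA, hB]
  ring

/-! ### The operator is linear, positive and preserves constants -/

section Operator

variable {η γ α : ℝ} {s m : ℕ} {z : ℝ}

theorem node_mem_Icc (hγ : 0 < γ) {j : ℕ} (hj : j ∈ Finset.range (m + 1)) {t : ℝ}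
    (ht : t ∈ Icc (0 : ℝ) 1) : ((j : ℝ) + t ^ γ) / ((m : ℝ) + 1) ∈ Icc (0 : ℝ) 1 := by
  have h0 : 0 ≤ t ^ γ := Real.rpow_nonneg ht.1 _
  have h1 : t ^ γ ≤ 1 := Real.rpow_le_one ht.1 ht.2 hγ.le
  have h2 : (j : ℝ) ≤ m := by exact_mod_cast Nat.lt_succ_iff.1 (Finset.mem_range.1 hj)
  refine ⟨by positivity, ?_⟩
  rw [div_le_one (by positivity)]
  linarith

theorem intervalIntegrable_kernel (hη : 0 < η) :
    IntervalIntegrable (fun t : ℝ => (1 - t) ^ (η - 1) / Real.Gamma η) MeasureTheory.volume 0 1 := by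
  have h := (intervalIntegral.intervalIntegrable_rpow' (a := 0) (b := 1)
    (by linarith : -1 < η - 1)).comp_sub_left 1
  simp only [sub_zero, sub_self] at h
  exact h.symm.div_const _

theorem integral_kernel (hη : 0 < η) :
    Real.Gamma (η + 1) * ∫ t in (0 : ℝ)..1, (1 - t) ^ (η - 1) / Real.Gamma η = 1 := by
  have hG : Real.Gamma η ≠ 0 := (Real.Gamma_pos_of_pos hη).ne'
  rw [intervalIntegral.integral_div,
    intervalIntegral.integral_comp_sub_left (fun t : ℝ => t ^ (η - 1)) 1,
    integral_rpow (Or.inl (by linarith)), Real.Gamma_add_one hη.ne']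
  simp [Real.zero_rpow hη.ne']
  field_simp

theorem intervalIntegrable_kernel_mul (hη : 0 < η) (hγ : 0 < γ) {f : ℝ → ℝ}
    (hf : ContinuousOn f (Icc 0 1)) {j : ℕ} (hj : j ∈ Finset.range (m + 1)) :
    IntervalIntegrable (fun t : ℝ => (1 - t) ^ (η - 1) / Real.Gamma η *
      f (((j : ℝ) + t ^ γ) / ((m : ℝ) + 1))) MeasureTheory.volume 0 1 := by
  refine (intervalIntegrable_kernel hη).mul_continuousOn ?_
  rw [uIcc_of_le zero_le_one]
  refine hf.comp (Continuous.continuousOn ?_) fun t ht => node_mem_Icc hγ hj ht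
  exact (continuous_const.add (Real.continuous_rpow_const hγ.le)).div_const _

theorem fracOp_add (hη : 0 < η) (hγ : 0 < γ) {f g : ℝ → ℝ} (hf : ContinuousOn f (Icc 0 1))
    (hg : ContinuousOn g (Icc 0 1)) :
    fracOp η γ α s m (fun t => f t + g t) z = fracOp η γ α s m f z + fracOp η γ α s m g z := by
  unfold fracOp
  rw [← mul_add, ← Finset.sum_add_distrib]
  congr 1
  refine Finset.sum_congr rfl fun j hj => ?_
  rw [← mul_add, ← intervalIntegral.integral_add (intervalIntegrable_kernel_mul hη hγ hf hj)
    (intervalIntegrable_kernel_mul hη hγ hg hj)]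
  simp only [mul_add]

theorem fracOp_const_mul (c : ℝ) (f : ℝ → ℝ) :
    fracOp η γ α s m (fun t => c * f t) z = c * fracOp η γ α s m f z := by
  unfold fracOp
  simp only [mul_left_comm _ c, intervalIntegral.integral_const_mul, ← Finset.mul_sum]

theorem fracOp_const (hη : 0 < η) (c : ℝ) : fracOp η γ α s m (fun _ => c) z = c := by
  unfold fracOp
  rw [← Finset.sum_mul, sum_blendingBasis, one_mul, intervalIntegral.integral_mul_const,
    ← mul_assoc, integral_kernel hη, one_mul]

theorem fracOp_mono (hη : 0 < η) (hγ : 0 < γ) (hα0 : 0 ≤ α) (hα1 : α ≤ 1)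
    (hz : z ∈ Icc (0 : ℝ) 1) {f g : ℝ → ℝ} (hf : ContinuousOn f (Icc 0 1))
    (hg : ContinuousOn g (Icc 0 1)) (hfg : ∀ t ∈ Icc (0 : ℝ) 1, f t ≤ g t) :
    fracOp η γ α s m f z ≤ fracOp η γ α s m g z := by
  unfold fracOp
  have hG := Real.Gamma_pos_of_pos hη
  have hG1 := Real.Gamma_pos_of_pos (by linarith : 0 < η + 1)
  refine mul_le_mul_of_nonneg_left (Finset.sum_le_sum fun j hj =>
    mul_le_mul_of_nonneg_left ?_ (blendingBasis_nonneg hα0 hα1 s m j hz)) hG1.le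
  refine intervalIntegral.integral_mono_on zero_le_one (intervalIntegrable_kernel_mul hη hγ hf hj)
    (intervalIntegrable_kernel_mul hη hγ hg hj) fun t ht => ?_
  refine mul_le_mul_of_nonneg_left (hfg _ (node_mem_Icc hγ hj ht)) ?_
  exact div_nonneg (Real.rpow_nonneg (sub_nonneg.2 ht.2) _) hG.le

theorem fracOp_quadratic (hη : 0 < η) (hγ : 0 < γ) (a b c : ℝ) :
    fracOp η γ α s m (fun t => a + (b * (t - z) + c * (t - z) ^ 2)) z =
      a + (b * centralMoment₁ η γ α s m z + c * centralMoment₂ η γ α s m z) := by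
  rw [fracOp_add hη hγ (by fun_prop) (by fun_prop), fracOp_add hη hγ (by fun_prop) (by fun_prop),
    fracOp_const hη, fracOp_const_mul, fracOp_const_mul]
  rfl

/-- An affine approximation with quadratic error transfers to the operator. -/
theorem abs_fracOp_sub_le (hη : 0 < η) (hγ : 0 < γ) (hα0 : 0 ≤ α) (hα1 : α ≤ 1)
    (hz : z ∈ Icc (0 : ℝ) 1) {f : ℝ → ℝ} (hf : ContinuousOn f (Icc 0 1)) {a b A B : ℝ}
    (hb : ∀ t ∈ Icc (0 : ℝ) 1, |f t - a - b * (t - z)| ≤ A + B * (t - z) ^ 2) :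
    |fracOp η γ α s m f z - a - b * centralMoment₁ η γ α s m z| ≤
      A + B * centralMoment₂ η γ α s m z := by
  have h1 := fracOp_mono (s := s) (m := m) hη hγ hα0 hα1 hz hf
    (g := fun t => (a + A) + (b * (t - z) + B * (t - z) ^ 2)) (by fun_prop)
    fun t ht => by linarith [(abs_le.1 (hb t ht)).2]
  have h2 := fracOp_mono (s := s) (m := m) hη hγ hα0 hα1 hz (g := f)
    (f := fun t => (a - A) + (b * (t - z) + (-B) * (t - z) ^ 2)) (by fun_prop) hf
    fun t ht => by linarith [(abs_le.1 (hb t ht)).1]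
  rw [fracOp_quadratic hη hγ] at h1 h2
  rw [abs_le]
  constructor <;> linarith

/-- Needed to evaluate `φ` at the mean, where the affine approximant is anchored. -/
theorem add_centralMoment₁_mem_Icc (hη : 0 < η) (hγ : 0 < γ) (hα0 : 0 ≤ α) (hα1 : α ≤ 1)
    (hz : z ∈ Icc (0 : ℝ) 1) : z + centralMoment₁ η γ α s m z ∈ Icc (0 : ℝ) 1 := by
  have h1 := fracOp_mono (s := s) (m := m) hη hγ hα0 hα1 hz (f := fun t => t - z)
    (g := fun _ => 1 - z) (by fun_prop) (by fun_prop) fun t ht => by linarith [ht.2]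
  have h2 := fracOp_mono (s := s) (m := m) hη hγ hα0 hα1 hz (g := fun t => t - z)
    (f := fun _ => -z) (by fun_prop) (by fun_prop) fun t ht => by linarith [ht.1]
  rw [fracOp_const hη] at h1 h2
  unfold centralMoment₁
  exact ⟨by linarith, by linarith⟩

theorem centralMoment₂_nonneg (hη : 0 < η) (hγ : 0 < γ) (hα0 : 0 ≤ α) (hα1 : α ≤ 1)
    (hz : z ∈ Icc (0 : ℝ) 1) : 0 ≤ centralMoment₂ η γ α s m z := by
  have h := fracOp_mono (s := s) (m := m) hη hγ hα0 hα1 hz (f := fun _ => 0)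
    (g := fun t => (t - z) ^ 2) (by fun_prop) (by fun_prop) fun t _ => sq_nonneg _
  rwa [fracOp_const hη] at h

/-- If the second central moment vanishes, the operator reproduces every continuous function. -/
theorem fracOp_eq_of_centralMoment₂_eq_zero (hη : 0 < η) (hγ : 0 < γ) (hα0 : 0 ≤ α) (hα1 : α ≤ 1)
    (hz : z ∈ Icc (0 : ℝ) 1) {φ : ℝ → ℝ} (hφ : ContinuousOn φ (Icc 0 1))
    (h0 : centralMoment₂ η γ α s m z = 0) : fracOp η γ α s m φ z = φ z := by
  -- The quadratic term, whatever its coefficient, is killed by the zero moment, leaving only `ε`.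
  refine eq_of_forall_dist_le fun ε hε => ?_
  obtain ⟨K, hK⟩ := exists_abs_sub_le_add_sq hφ hz hε
  have h := abs_fracOp_sub_le (s := s) (m := m) (a := φ z) (b := 0) hη hγ hα0 hα1 hz hφ
    (fun t ht => by simpa using hK t ht)
  simpa [h0, Real.dist_eq] using h

/-- Since `(t - x)² ≤ 2(t - z)² + 2ζ²`, the operator sends `(t - x)² / h²` to at most `2 · 4h² / h²
= 8`, and `247 = 19 (5 + 8)`. -/
theorem abs_fracOp_sub_mean_le (hη : 0 < η) (hγ : 0 < γ) (hα0 : 0 ≤ α) (hα1 : α ≤ 1)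
    (hz : z ∈ Icc (0 : ℝ) 1) {φ : ℝ → ℝ} (hφ : ContinuousOn φ (Icc 0 1)) {h : ℝ} (hh : 0 < h)
    (hm : centralMoment₂ η γ α s m z + centralMoment₁ η γ α s m z ^ 2 = 4 * h ^ 2) :
    |fracOp η γ α s m φ z - φ (z + centralMoment₁ η γ α s m z)| ≤ 247 * modulus₂ φ h := by
  have hx := add_centralMoment₁_mem_Icc (s := s) (m := m) hη hγ hα0 hα1 hz
  obtain ⟨a, ha⟩ := exists_slope_modulus₂ hφ hh hx
  have hw := modulus₂_nonneg φ h
  set ζ := centralMoment₁ η γ α s m z with hζ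
  set w := modulus₂ φ h
  have hb : ∀ t ∈ Icc (0 : ℝ) 1, |φ t - (φ (z + ζ) - a * ζ) - a * (t - z)| ≤
      19 * w * (5 + 2 * ζ ^ 2 / h ^ 2) + 38 * w / h ^ 2 * (t - z) ^ 2 := by
    intro t ht
    rw [show φ t - (φ (z + ζ) - a * ζ) - a * (t - z) = φ t - φ (z + ζ) - a * (t - (z + ζ)) by ring]
    refine (ha t ht).trans ?_
    have h1 : (t - (z + ζ)) ^ 2 / h ^ 2 ≤ (2 * (t - z) ^ 2 + 2 * ζ ^ 2) / h ^ 2 := by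
      gcongr
      nlinarith [sq_nonneg (t - z + ζ)]
    calc 19 * (5 + (t - (z + ζ)) ^ 2 / h ^ 2) * w
        ≤ 19 * (5 + (2 * (t - z) ^ 2 + 2 * ζ ^ 2) / h ^ 2) * w := by gcongr
      _ = _ := by ring
  have hfin := abs_fracOp_sub_le (s := s) (m := m) hη hγ hα0 hα1 hz hφ hb
  rw [← hζ, sub_sub, sub_add_cancel] at hfin
  refine hfin.trans (le_of_eq ?_)
  rw [eq_sub_of_add_eq hm]
  field_simp
  ring

end Operator

end FracBernstein

theorem theorem5 :
    ∃ C : ℝ, 0 < C ∧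
      ∀ (η γ α : ℝ) (s m : ℕ), 0 < η → 0 < γ → 0 ≤ α → α ≤ 1 →
        ∀ φ : ℝ → ℝ, ContinuousOn φ (Set.Icc (0 : ℝ) 1) →
          ∀ z ∈ Set.Icc (0 : ℝ) 1,
            |FracBernstein.fracOp η γ α s m φ z - φ z| ≤
              C * FracBernstein.modulus₂ φ
                  (1 / 2 * Real.sqrt (FracBernstein.centralMoment₂ η γ α s m z
                    + FracBernstein.centralMoment₁ η γ α s m z ^ 2))
                + FracBernstein.modulus φ |FracBernstein.centralMoment₁ η γ α s m z| := by
  refine ⟨247, by norm_num, fun η γ α s m hη hγ hα0 hα1 φ hφ z hz => ?_⟩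
  have h2 := FracBernstein.centralMoment₂_nonneg (s := s) (m := m) hη hγ hα0 hα1 hz
  -- The estimate at the mean divides by `h²`, so the degenerate case is treated apart.
  rcases h2.eq_or_lt with h0 | hpos
  · rw [FracBernstein.fracOp_eq_of_centralMoment₂_eq_zero hη hγ hα0 hα1 hz hφ h0.symm, sub_self,
      abs_zero]
    exact add_nonneg (mul_nonneg (by norm_num) (FracBernstein.modulus₂_nonneg _ _))
      (FracBernstein.modulus_nonneg _ _)
  have hsum : 0 < FracBernstein.centralMoment₂ η γ α s m z
      + FracBernstein.centralMoment₁ η γ α s m z ^ 2 := by positivity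
  have h3 := FracBernstein.abs_fracOp_sub_mean_le (s := s) (m := m) hη hγ hα0 hα1 hz hφ
    (mul_pos one_half_pos (Real.sqrt_pos.2 hsum))
    (by rw [mul_pow, Real.sq_sqrt hsum.le]; ring)
  have h4 := FracBernstein.abs_sub_le_modulus hφ
    (FracBernstein.add_centralMoment₁_mem_Icc (s := s) (m := m) hη hγ hα0 hα1 hz) hz
  rw [add_sub_cancel_left] at h4
  exact (abs_sub_le _ _ _).trans (add_le_add h3 h4)
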